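/- **Theorem.** Let $H,G>0$, let $\mathcal W\subset\mathbb R^d$ be non-empty, convex, closed and bounded, let $B=\sup_{w\in\mathcal W}\|w\|_\infty$ and let $\mathcal D=\{x\in\mathbb R^d:\|x\|_\infty\le B\}$ be the circumscribing box. Let $f_1,\dots,f_n$ be losses that are $H$-strongly convex across $\mathcal D$ in the Euclidean norm, i.e. $f_t(y)\ge f_t(x)+\nabla f_t(x)^T(y-x)+\frac H2\|y-x\|_2^2$ for all $x,y\in\mathcal D$, and satisfy $\|\nabla f_t(x)\|_\infty\le G$ for all $x\in\mathcal D$ (if $f_t$ is not differentiable, $\nabla f_t(x)$ stands for a choice of subgradient with these two properties). Write $\Pi_{\mathcal W}(x)\in\arg\min_{y\in\mathcal W}\|x-y\|_1$ for an (arbitrary) choice of $\ell_1$-projection and $S(x)=\|x-\Pi_{\mathcal W}(x)\|_1$. Consider the following learner, which knows $\mathcal W$, $H$ and $G$ only. In round $t=1,\dots,n$: 1. it computes a point $x_t$ coordinate by coordinate: $x_t[i]$ is the prediction of the $i$-th of $d$ instances of the univariate algorithm FLH-OGD described below, with decision set $[-B,B]$ and learning rate $\zeta=1/\big(2(2B+2G/H)^2\big)$;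 2. it plays $\hat x_t=\Pi_{\mathcal W}(x_t)$, and the loss $f_t$ is revealed; 3. it takes a subgradient $p_t=\nabla f_t(x_t)+G s_t$, $s_t\in\partial S(x_t)$, of the surrogate loss $\ell_t(x)=f_t(x)+G\,S(x)$ at $x_t$, and sends to the $i$-th instance the univariate loss $\ell_t^{(i)}(z)=\big(z-(x_t[i]-p_t[i]/H)\big)^2$, $i=1,\dots,d$. FLH-OGD on losses $h_1,h_2,\dots$ works as follows. Base learner $j$ ($j=1,2,\dots$) is started at time $j$ from an arbitrary point of $[-B,B]$ and runs projected online gradient descent on $[-B,B]$ with step size $1/(2k)$ after its $k$-th round; let $E^j_t$ be its prediction at time $t\ge j$. The prediction at time $t$ is $\sum_{j=1}^t v_t^{(j)}E^j_t$, where $v_1^{(1)}=1$, $v_{t+1}^{(t+1)}=\frac1{t+1}$ and, for $1\le i\le t$, $v_{t+1}^{(i)}=\big(1-\frac1{t+1}\big)\,v_t^{(i)}e^{-\zeta h_t(E^i_t)}\big/\sum_{j=1}^t v_t^{(j)}e^{-\zeta h_t(E^j_t)}$. Then the learner is proper, $\hat x_t\in\mathcal W$ for all $t$, and simultaneously for every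 $C_n$ and every comparator sequence $w_1,\dots,w_n\in\mathcal W$ with $\sum_{t=2}^n\|w_t-w_{t-1}\|_1\le C_n$, $$\sum_{t=1}^n\big(f_t(\hat x_t)-f_t(w_t)\big)\;\le\;K\,(1+\log n)^k\,\max\big\{d^{1/3}n^{1/3}C_n^{2/3},\;d\big\},$$ where $k$ is an absolute constant and $K$ depends only on $H$ and $G$. -/

import Mathlib

open Finset

noncomputable section

namespace BoxReduction

/-! ### Univariate FLH-OGD -/

/-- Projection of a real number onto the interval `[-B, B]`. -/
def clip (B z : ℝ) : ℝ := max (-B) (min B z)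

/-- Projected online gradient descent on `[-B, B]`, started at time `j` from the point `z₁`, on the
losses `f j, f (j + 1), …`. `ogd B z₁ f j τ` is the prediction at time `j + τ`; the step size used
after the `k`-th round of play is `1 / (2 k)`. -/
def ogd (B z₁ : ℝ) (f : ℕ → ℝ → ℝ) (j : ℕ) : ℕ → ℝ
  | 0 => z₁
  | τ + 1 =>
    clip B (ogd B z₁ f j τ
      - 1 / (2 * ((τ : ℝ) + 1)) * deriv (f (j + τ)) (ogd B z₁ f j τ))

/-- The weights `v_t^{(i)}` of Follow-the-Leading-History with learning rate `ζ`, where `E i t` is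
the prediction of base learner `i` at time `t` (`1 ≤ i ≤ t`) and `f t` is the loss at time `t`.
The equation at `t + 1` with `t = 0` is the initialization `v_1^{(1)} = 1`. -/
def flhWeight (ζ : ℝ) (E : ℕ → ℕ → ℝ) (f : ℕ → ℝ → ℝ) : ℕ → ℕ → ℝ
  | 0, _ => 0
  | t + 1, i =>
    if i = t + 1 then 1 / ((t : ℝ) + 1)
    else (1 - 1 / ((t : ℝ) + 1)) *
      (flhWeight ζ E f t i * Real.exp (-ζ * f t (E i t)) /
        ∑ j ∈ Icc 1 t, flhWeight ζ E f t j * Real.exp (-ζ * f t (E j t)))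

/-- The prediction of FLH at time `t ≥ 1`. -/
def flhPlay (ζ : ℝ) (E : ℕ → ℕ → ℝ) (f : ℕ → ℝ → ℝ) (t : ℕ) : ℝ :=
  ∑ j ∈ Icc 1 t, flhWeight ζ E f t j * E j t

/-- The prediction at time `t ≥ 1` of univariate FLH-OGD on `[-B, B]` with learning rate `ζ`: base
learner `j` is projected OGD started at time `j` from the point `z₁ j`. It depends only on the
losses `f 1, …, f (t - 1)`. -/
def flhOgd (B ζ : ℝ) (z₁ : ℕ → ℝ) (f : ℕ → ℝ → ℝ) (t : ℕ) : ℝ :=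
  flhPlay ζ (fun j s => ogd B (z₁ j) f j (s - j)) f t

/-! ### Vectors in `ℝ^d`; the norm of `Fin d → ℝ` is the sup norm -/

/-- The `ℓ¹` norm. -/
def l1Norm {d : ℕ} (x : Fin d → ℝ) : ℝ := ∑ i, |x i|

/-- `TV(w_{1:n}) = ∑_{t=2}^n ‖w_t - w_{t-1}‖₁`. -/
def totalVariation {d : ℕ} (n : ℕ) (w : ℕ → Fin d → ℝ) : ℝ :=
  ∑ t ∈ Icc 2 n, l1Norm (w t - w (t - 1))

/-- The box `{x : ‖x‖_∞ ≤ B}`. -/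
def box (d : ℕ) (B : ℝ) : Set (Fin d → ℝ) := {x | ‖x‖ ≤ B}

/-- `sup_{w ∈ W} ‖w‖_∞`, the radius of the tightest centred box that contains `W`. -/
def boxRadius {d : ℕ} (W : Set (Fin d → ℝ)) : ℝ := sSup ((fun w => ‖w‖) '' W)

/-- `f` is `H`-strongly convex in the Euclidean norm across the box of radius `B`, with (sub)gradient
map `g` bounded by `G` in sup norm. If `f` is differentiable then `g` can be taken to be `∇f`; at an
interior point of the box where `f` is differentiable, `g x = ∇f x` is the only possibility. -/
structure IsStronglyConvexLoss {d : ℕ} (H G B : ℝ) (f : (Fin d → ℝ) → ℝ)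
    (g : (Fin d → ℝ) → (Fin d → ℝ)) : Prop where
  strong : ∀ x ∈ box d B, ∀ y ∈ box d B,
    f x + ∑ i, g x i * (y i - x i) + H / 2 * ∑ i, (y i - x i) ^ 2 ≤ f y
  bound : ∀ x ∈ box d B, ‖g x‖ ≤ G

/-- `proj x` is a point of `argmin_{y ∈ W} ‖x - y‖₁`, for every `x`. -/
def IsL1Projection {d : ℕ} (W : Set (Fin d → ℝ)) (proj : (Fin d → ℝ) → (Fin d → ℝ)) : Prop :=
  ∀ x, proj x ∈ W ∧ ∀ y ∈ W, l1Norm (x - proj x) ≤ l1Norm (x - y)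

/-- `S(x) = ‖x - Π_W(x)‖₁`. -/
def l1Gap {d : ℕ} (proj : (Fin d → ℝ) → (Fin d → ℝ)) (x : Fin d → ℝ) : ℝ :=
  l1Norm (x - proj x)

/-- The subdifferential at `x` of a function on `ℝ^d`. -/
def subdifferential {d : ℕ} (S : (Fin d → ℝ) → ℝ) (x : Fin d → ℝ) : Set (Fin d → ℝ) :=
  {s | ∀ y, S x + ∑ i, s i * (y i - x i) ≤ S y}

/-- The values at `x` of the (sub)gradient of the surrogate loss `ℓ = f + G • S`, where
`S(x) = ‖x - Π_W(x)‖₁` and `g` is the (sub)gradient map of `f`: the vectors `g x + G • s` with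
`s` a subgradient of `S` at `x`. -/
def surrogateGradients {d : ℕ} (G : ℝ) (proj g : (Fin d → ℝ) → (Fin d → ℝ)) (x : Fin d → ℝ) :
    Set (Fin d → ℝ) :=
  {p | ∃ s ∈ subdifferential (l1Gap proj) x, p = g x + G • s}

/-! ### The algorithm for the box and the reduction -/

/-- The univariate surrogate losses `z ↦ (z - (x_t[i] - p_t[i] / H))²` of coordinate `i`, where `x_t`
is the prediction and `p_t` the (sub)gradient received at `x_t`. -/
def coordLoss {d : ℕ} (H : ℝ) (x p : ℕ → Fin d → ℝ) (i : Fin d) (t : ℕ) (z : ℝ) : ℝ :=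
  (z - (x t i - p t i / H)) ^ 2

/-- `x` is the sequence of predictions over `n` rounds of the algorithm for the box of radius `B`
(`d` instances of FLH-OGD, one for each coordinate) with parameters `H`, `Ginf` and starting points
`z₁`, when the (sub)gradient received in round `t` is `p t`. -/
def IsBoxAlgorithmRun {d : ℕ} (n : ℕ) (B H Ginf : ℝ) (z₁ : Fin d → ℕ → ℝ)
    (p x : ℕ → Fin d → ℝ) : Prop :=
  ∀ t ∈ Icc 1 n, ∀ i,
    x t i = flhOgd B (1 / (2 * (2 * B + Ginf / H) ^ 2)) (z₁ i) (coordLoss H x p i) t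

/-- A run over `n` rounds of the reduction from the convex set `W` to its circumscribing box, against
losses with (sub)gradient maps `g t`: in round `t` the box algorithm, run with `Ginf = 2 G`, predicts
`x t`, the learner plays `xhat t`, and the box algorithm is sent the surrogate loss
`ℓ_t = f_t + G • S`, of which it uses the (sub)gradient `p t` at `x t`. -/
structure IsReductionRun {d : ℕ} (n : ℕ) (W : Set (Fin d → ℝ)) (H G : ℝ)
    (proj : (Fin d → ℝ) → (Fin d → ℝ)) (g : ℕ → (Fin d → ℝ) → (Fin d → ℝ))
    (z₁ : Fin d → ℕ → ℝ) (p x xhat : ℕ → Fin d → ℝ) : Prop where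
  start : ∀ i j, z₁ i j ∈ Set.Icc (-boxRadius W) (boxRadius W)
  predict : IsBoxAlgorithmRun n (boxRadius W) H (2 * G) z₁ p x
  play : ∀ t ∈ Icc 1 n, xhat t = proj (x t)
  feedback : ∀ t ∈ Icc 1 n, p t ∈ surrogateGradients G proj (g t) (x t)

end BoxReduction

end

/-! Since `f` is `G`-Lipschitz in ℓ¹ on the box, f(Π x) ≤ f(x) + G S(x), and S vanishes on `W`.
Strong convexity and a completed square then bound the regret of one round by H/2 times a sum over
coordinates of regrets for the losses (z - y)², y = x - p/H (`sub_le_sum_coord`). It remains to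
bound the univariate dynamic regret by 1 + n^{1/3} V^{2/3}, up to logarithms, and to sum over
coordinates by Hölder.

In one variable, the squared loss is exp-concave, so on any interval FLH follows the base learner
born at its left end at logarithmic cost, and that learner is OGD with small regret against slowly
moving comparators (`flhOgd_adaptive_regret`). Put q = (V/n)^{1/3}; the target is n q². If q ≤ 2B,
the comparator is rounded to a grid of mesh about q with a random threshold: on average the
first-order error vanishes, the second-order error is at most n q², and there are about V/q = n q²
changes of value (`dynamic_regret_of_rounding`). If q > 2B, time is cut into blocks of length about
1/q², and OGD absorbs the movement inside each block (`sum_le_of_blocks`).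

Constants depend on `H` and `G` only because strong convexity with bounded gradients forces B ≤ G/H
(`radius_le`). -/

namespace BoxReduction

/-! ### Projected online gradient descent on squared losses -/

lemma clip_mem {B : ℝ} (hB : 0 ≤ B) (z : ℝ) : clip B z ∈ Set.Icc (-B) B :=
  ⟨le_max_left _ _, max_le (by linarith) (min_le_left _ _)⟩

lemma clip_sub_sq_le {B u : ℝ} (hu : u ∈ Set.Icc (-B) B) (z : ℝ) :
    (clip B z - u) ^ 2 ≤ (z - u) ^ 2 := by
  obtain ⟨h1, h2⟩ := hu
  unfold clip
  rcases le_total B z with h | h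
  · rw [min_eq_left h, max_eq_right (by linarith)]
    nlinarith
  · rw [min_eq_right h]
    rcases le_total (-B) z with h' | h'
    · rw [max_eq_right h']
    · rw [max_eq_left h']
      nlinarith

/-- The squared losses with labels `y`. -/
def sqLoss (y : ℕ → ℝ) (t : ℕ) (z : ℝ) : ℝ := (z - y t) ^ 2

lemma deriv_sqLoss (y : ℕ → ℝ) (t : ℕ) (z : ℝ) : deriv (sqLoss y t) z = 2 * (z - y t) := by
  have h : HasDerivAt (sqLoss y t) (((2 : ℕ) : ℝ) * (z - y t) ^ (2 - 1) * 1) z :=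
    ((hasDerivAt_id z).sub_const (y t)).pow 2
  rw [h.deriv]
  norm_num

lemma ogd_mem {B z : ℝ} (hz : z ∈ Set.Icc (-B) B) (f : ℕ → ℝ → ℝ) (j τ : ℕ) :
    ogd B z f j τ ∈ Set.Icc (-B) B := by
  have hB : 0 ≤ B := by linarith [hz.1, hz.2]
  cases τ with
  | zero => exact hz
  | succ τ => exact clip_mem hB _

/-- The loss difference is 2(e - c)(e - u) - (e - u)². The curvature term -(e - u)² lowers the
weight of the old squared distance from τ + 1 to τ, so the weighted distances telescope over rounds.
-/
lemma ogd_sqLoss_step {B z D u : ℝ} (hu : u ∈ Set.Icc (-B) B) (y : ℕ → ℝ) (j τ : ℕ)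
    (hD : |ogd B z (sqLoss y) j τ - y (j + τ)| ≤ D) :
    (ogd B z (sqLoss y) j τ - y (j + τ)) ^ 2 - (u - y (j + τ)) ^ 2
      + (τ + 1) * (ogd B z (sqLoss y) j (τ + 1) - u) ^ 2
      ≤ τ * (ogd B z (sqLoss y) j τ - u) ^ 2 + D ^ 2 * (1 / ((τ : ℝ) + 1)) := by
  have hτ : (0 : ℝ) < (τ : ℝ) + 1 := by positivity
  have hstep : (ogd B z (sqLoss y) j (τ + 1) - u) ^ 2 ≤
      (ogd B z (sqLoss y) j τ - (ogd B z (sqLoss y) j τ - y (j + τ)) / ((τ : ℝ) + 1) - u) ^ 2 := by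
    refine le_of_eq_of_le ?_ (clip_sub_sq_le hu _)
    rw [ogd, deriv_sqLoss]
    congr 3
    field_simp
  have hD2 := sq_le_sq.2 (hD.trans (le_abs_self D))
  set e := ogd B z (sqLoss y) j τ
  set c := y (j + τ)
  have h1 := mul_le_mul_of_nonneg_left hstep hτ.le
  have h2 : ((τ : ℝ) + 1) * (e - (e - c) / ((τ : ℝ) + 1) - u) ^ 2 =
      (τ + 1) * (e - u) ^ 2 - 2 * (e - c) * (e - u) + (e - c) ^ 2 * (1 / ((τ : ℝ) + 1)) := by
    field_simp
    ring
  have h3 : (e - c) ^ 2 * (1 / ((τ : ℝ) + 1)) ≤ D ^ 2 * (1 / ((τ : ℝ) + 1)) :=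
    mul_le_mul_of_nonneg_right hD2 (by positivity)
  nlinarith

lemma sq_sub_le_sq_sub_add {B e u u' : ℝ} (he : e ∈ Set.Icc (-B) B) (hu : u ∈ Set.Icc (-B) B)
    (hu' : u' ∈ Set.Icc (-B) B) : (e - u') ^ 2 ≤ (e - u) ^ 2 + 4 * B * |u' - u| := by
  have h : |2 * e - u - u'| ≤ 4 * B := by
    rw [abs_le]
    constructor <;> linarith [he.1, he.2, hu.1, hu.2, hu'.1, hu'.2]
  have h2 : (u - u') * (2 * e - u - u') ≤ |u' - u| * (4 * B) := by
    refine (le_abs_self _).trans ?_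
    rw [abs_mul, abs_sub_comm]
    gcongr
  nlinarith

/-- Dynamic regret of projected online gradient descent on squared losses. -/
lemma ogd_dynamic_regret {B z D : ℝ} (hz : z ∈ Set.Icc (-B) B) (y w : ℕ → ℝ) (j N : ℕ) :
    ∀ m : ℕ, m < N → (∀ τ ≤ m, w (j + τ) ∈ Set.Icc (-B) B) →
      (∀ τ ≤ m, |ogd B z (sqLoss y) j τ - y (j + τ)| ≤ D) →
      ∑ τ ∈ range (m + 1),
          ((ogd B z (sqLoss y) j τ - y (j + τ)) ^ 2 - (w (j + τ) - y (j + τ)) ^ 2)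
        + (m + 1) * (ogd B z (sqLoss y) j (m + 1) - w (j + m)) ^ 2
      ≤ D ^ 2 * ∑ τ ∈ range (m + 1), 1 / ((τ : ℝ) + 1)
        + 4 * B * N * ∑ τ ∈ range m, |w (j + τ + 1) - w (j + τ)|
  | 0, _, hw, hD => by
    have h := ogd_sqLoss_step (hw 0 le_rfl) y j 0 (hD 0 le_rfl)
    simpa using h
  | m + 1, hN, hw, hD => by
    have ih := ogd_dynamic_regret hz y w j N m (by omega) (fun τ h => hw τ (by omega))
      (fun τ h => hD τ (by omega))
    have h := ogd_sqLoss_step (hw (m + 1) le_rfl) y j (m + 1) (hD (m + 1) le_rfl)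
    have hB : 0 ≤ B := by linarith [hz.1, hz.2]
    -- Moving the comparator changes the potential (m + 1)(e - w)² by at most (m + 1) · 4B|Δw|; the
    -- length bound `N` makes this uniform.
    have hs := mul_le_mul_of_nonneg_left (sq_sub_le_sq_sub_add
      (ogd_mem hz (sqLoss y) j (m + 1)) (hw m (by omega)) (hw (m + 1) le_rfl))
      (show (0 : ℝ) ≤ (m : ℝ) + 1 by positivity)
    have hmN : ((m : ℝ) + 1) ≤ N := by exact_mod_cast (show m + 1 ≤ N by omega)
    have hs2 : ((m : ℝ) + 1) * (4 * B * |w (j + (m + 1)) - w (j + m)|) ≤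
        N * (4 * B * |w (j + (m + 1)) - w (j + m)|) := by gcongr
    rw [sum_range_succ _ (m + 1), sum_range_succ _ (m + 1),
      sum_range_succ (fun τ => |w (j + τ + 1) - w (j + τ)|) m, add_assoc j m 1]
    push_cast at h ⊢
    linarith

/-! ### Follow-the-leading-history -/

lemma flhWeight_pos_and_sum (ζ : ℝ) (E : ℕ → ℕ → ℝ) (f : ℕ → ℝ → ℝ) {t : ℕ} (ht : 1 ≤ t) :
    (∀ i ∈ Icc 1 t, 0 < flhWeight ζ E f t i) ∧ ∑ i ∈ Icc 1 t, flhWeight ζ E f t i = 1 := by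
  induction t, ht using Nat.le_induction with
  | base =>
    constructor
    · intro i hi
      obtain rfl : i = 1 := by simpa using hi
      simp [flhWeight]
    · simp [flhWeight]
  | succ t ht ih =>
    have ht' : (1 : ℝ) ≤ t := by exact_mod_cast ht
    have hZ : 0 < ∑ j ∈ Icc 1 t, flhWeight ζ E f t j * Real.exp (-ζ * f t (E j t)) :=
      sum_pos (fun j hj => mul_pos (ih.1 j hj) (Real.exp_pos _)) ⟨1, by simp [ht]⟩
    have hc : 0 < 1 - 1 / ((t : ℝ) + 1) := by
      rw [sub_pos, div_lt_one (by positivity)]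
      linarith
    constructor
    · intro i hi
      rw [mem_Icc] at hi
      rw [flhWeight]
      split_ifs with h
      · positivity
      · exact mul_pos hc (div_pos (mul_pos (ih.1 i (mem_Icc.2 ⟨hi.1, by omega⟩))
          (Real.exp_pos _)) hZ)
    · rw [sum_Icc_succ_top (by omega)]
      have h : ∑ i ∈ Icc 1 t, flhWeight ζ E f (t + 1) i = 1 - 1 / ((t : ℝ) + 1) := by
        rw [sum_congr rfl (fun i hi => by
          rw [flhWeight, if_neg (by have := (mem_Icc.1 hi).2; omega)]),
          ← mul_sum, ← sum_div, div_self hZ.ne', mul_one]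
      rw [h, flhWeight, if_pos rfl]
      ring

lemma flhPlay_mem {s : Set ℝ} (hs : Convex ℝ s) (ζ : ℝ) {E : ℕ → ℕ → ℝ} (f : ℕ → ℝ → ℝ)
    {t : ℕ} (ht : 1 ≤ t) (hE : ∀ i ∈ Icc 1 t, E i t ∈ s) : flhPlay ζ E f t ∈ s := by
  obtain ⟨hpos, hsum⟩ := flhWeight_pos_and_sum ζ E f ht
  exact hs.sum_mem (fun i hi => (hpos i hi).le) hsum hE

/-- The second derivative is exp(-ζ(z - c)²) · 2ζ(2ζ(z - c)² - 1), which is nonpositive while |z -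
c| ≤ D because 2ζD² = 1. -/
lemma concaveOn_exp_neg_sq {D : ℝ} (hD : 0 < D) (c : ℝ) :
    ConcaveOn ℝ (Set.Icc (c - D) (c + D))
      (fun z => Real.exp (-(1 / (2 * D ^ 2)) * (z - c) ^ 2)) := by
  set ζ := 1 / (2 * D ^ 2) with hζ
  have hζpos : 0 < ζ := by positivity
  have hd1 : ∀ z, HasDerivAt (fun z => Real.exp (-ζ * (z - c) ^ 2))
      (Real.exp (-ζ * (z - c) ^ 2) * (-ζ * (2 * (z - c)))) z := by
    intro z
    have h := (((hasDerivAt_id z).sub_const c).pow 2).const_mul (-ζ)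
    have h2 := h.exp
    simpa using h2
  have hd2 : ∀ z, HasDerivAt (fun z => Real.exp (-ζ * (z - c) ^ 2) * (-ζ * (2 * (z - c))))
      (Real.exp (-ζ * (z - c) ^ 2) * (-ζ * (2 * (z - c))) * (-ζ * (2 * (z - c)))
        + Real.exp (-ζ * (z - c) ^ 2) * (-ζ * (2 * 1))) z := by
    intro z
    exact (hd1 z).mul ((((hasDerivAt_id z).sub_const c).const_mul 2).const_mul (-ζ))
  have e1 : deriv (fun z => Real.exp (-ζ * (z - c) ^ 2)) =
      fun z => Real.exp (-ζ * (z - c) ^ 2) * (-ζ * (2 * (z - c))) :=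
    funext fun z => (hd1 z).deriv
  refine concaveOn_of_deriv2_nonpos (convex_Icc _ _)
    (fun z _ => (hd1 z).continuousAt.continuousWithinAt)
    (fun z _ => (hd1 z).differentiableAt.differentiableWithinAt) ?_ ?_
  · rw [e1]
    exact fun z _ => (hd2 z).differentiableAt.differentiableWithinAt
  · intro z hz
    rw [interior_Icc] at hz
    rw [show deriv^[2] (fun z => Real.exp (-ζ * (z - c) ^ 2)) z =
      deriv (deriv fun z => Real.exp (-ζ * (z - c) ^ 2)) z from rfl, e1, (hd2 z).deriv]
    have h1 : (z - c) ^ 2 ≤ D ^ 2 := sq_le_sq' (by linarith [hz.1]) (by linarith [hz.2])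
    have h2 : 2 * ζ * (z - c) ^ 2 ≤ 1 := by
      rw [hζ, mul_one_div, div_mul_eq_mul_div, div_le_one (by positivity)]
      linarith
    have h3 : Real.exp (-ζ * (z - c) ^ 2) * (2 * ζ) * (2 * ζ * (z - c) ^ 2 - 1) ≤ 0 :=
      mul_nonpos_of_nonneg_of_nonpos (by positivity) (by linarith)
    linarith

/-- Regret of follow-the-leading-history against the base learner `r` over an interval that starts
at time `r`. -/
lemma flh_regret {ζ : ℝ} {E : ℕ → ℕ → ℝ} {f : ℕ → ℝ → ℝ} {r s : ℕ} (hr : 1 ≤ r)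
    (hrs : r ≤ s)
    (hmix : ∀ t ∈ Ico r s, ∑ j ∈ Icc 1 t, flhWeight ζ E f t j * Real.exp (-ζ * f t (E j t)) ≤
      Real.exp (-ζ * f t (flhPlay ζ E f t))) :
    ζ * ∑ t ∈ Ico r s, (f t (flhPlay ζ E f t) - f t (E r t)) ≤ Real.log s := by
  -- The log-weight of learner `r` is the potential. Its initial value -log r cancels log r, and the
  -- factors s/(s + 1) telescope into log s.
  have key : ζ * ∑ t ∈ Ico r s, (f t (flhPlay ζ E f t) - f t (E r t)) ≤
      Real.log (flhWeight ζ E f s r) + Real.log s := by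
    induction s, hrs using Nat.le_induction with
    | base =>
      obtain ⟨m, rfl⟩ : ∃ m, r = m + 1 := ⟨r - 1, by omega⟩
      simp [flhWeight]
    | succ s hs ih =>
      have ih := ih (fun t ht => hmix t (by simp at ht ⊢; omega))
      have hm := hmix s (by simp [hs])
      have hv : 0 < flhWeight ζ E f s r :=
        (flhWeight_pos_and_sum ζ E f (hr.trans hs)).1 r (by simp [hr, hs])
      have hZ : 0 < ∑ j ∈ Icc 1 s, flhWeight ζ E f s j * Real.exp (-ζ * f s (E j s)) :=
        sum_pos (fun j hj => mul_pos ((flhWeight_pos_and_sum ζ E f (hr.trans hs)).1 j hj)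
          (Real.exp_pos _)) ⟨1, by simp; omega⟩
      have hlogZ := Real.log_le_log hZ hm
      rw [Real.log_exp] at hlogZ
      have hs0 : (0 : ℝ) < s := by exact_mod_cast (show 0 < s by omega)
      rw [sum_Ico_succ_top hs, flhWeight, if_neg (by omega)]
      set Z := ∑ j ∈ Icc 1 s, flhWeight ζ E f s j * Real.exp (-ζ * f s (E j s))
      have hc : 1 - 1 / ((s : ℝ) + 1) = s / (s + 1) := by field_simp; ring
      rw [hc, Real.log_mul (by positivity) (by positivity), Real.log_div (by positivity)
        (by positivity), Real.log_div (by positivity) (by positivity), Real.log_mul hv.ne'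
        (by positivity), Real.log_exp]
      push_cast
      linarith
  have hw := flhWeight_pos_and_sum ζ E f (hr.trans hrs)
  have hle : flhWeight ζ E f s r ≤ 1 := hw.2 ▸
    single_le_sum (fun i hi => (hw.1 i hi).le) (mem_Icc.2 ⟨hr, hrs⟩)
  have := Real.log_nonpos (hw.1 r (mem_Icc.2 ⟨hr, hrs⟩)).le hle
  linarith

/-! ### Strongly adaptive regret of FLH-OGD -/

lemma flhOgd_mem {B : ℝ} {z : ℕ → ℝ} (hz : ∀ j, z j ∈ Set.Icc (-B) B) (ζ : ℝ)
    (f : ℕ → ℝ → ℝ) {t : ℕ} (ht : 1 ≤ t) : flhOgd B ζ z f t ∈ Set.Icc (-B) B :=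
  flhPlay_mem (convex_Icc _ _) ζ f ht fun i _ => ogd_mem (hz i) f i (t - i)

lemma sum_range_one_div_le (m : ℕ) :
    ∑ τ ∈ range m, 1 / ((τ : ℝ) + 1) ≤ 1 + Real.log m := by
  have h := harmonic_le_one_add_log m
  unfold harmonic at h
  push_cast at h
  simpa using h

lemma log_succ_le {n : ℕ} : Real.log ((n : ℝ) + 1) ≤ 1 + Real.log n := by
  rcases Nat.eq_zero_or_pos n with rfl | hn
  · simp
  · have hn' : (1 : ℝ) ≤ n := by exact_mod_cast hn
    have h : Real.log ((n : ℝ) + 1) ≤ Real.log (2 * n) :=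
      Real.log_le_log (by positivity) (by linarith)
    rw [Real.log_mul (by norm_num) (by positivity)] at h
    have := Real.log_two_lt_d9
    linarith

/-- On every subinterval `[r, s)` of the first `n` rounds, of length at most `N`, FLH-OGD has small
dynamic regret for squared losses. -/
lemma flhOgd_adaptive_regret {B D : ℝ} (hD : 0 < D) {z : ℕ → ℝ}
    (hz : ∀ j, z j ∈ Set.Icc (-B) B) {n : ℕ} {y w : ℕ → ℝ}
    (hy : ∀ t ∈ Icc 1 n, ∀ e ∈ Set.Icc (-B) B, |e - y t| ≤ D)
    {r s N : ℕ} (hr : 1 ≤ r) (hrs : r < s) (hs : s ≤ n + 1) (hN : s ≤ r + N)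
    (hw : ∀ t ∈ Ico r s, w t ∈ Set.Icc (-B) B) :
    ∑ t ∈ Ico r s, ((flhOgd B (1 / (2 * D ^ 2)) z (sqLoss y) t - y t) ^ 2 - (w t - y t) ^ 2) ≤
      3 * D ^ 2 * (1 + Real.log n) + 4 * B * N * ∑ t ∈ Ico (r + 1) s, |w t - w (t - 1)| := by
  obtain ⟨m, rfl⟩ : ∃ m, s = r + m + 1 := ⟨s - r - 1, by omega⟩
  set E : ℕ → ℕ → ℝ := fun j t => ogd B (z j) (sqLoss y) j (t - j) with hE
  have hflh := flh_regret (ζ := 1 / (2 * D ^ 2)) (E := E) (f := sqLoss y) hr hrs.le (by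
    intro t ht
    rw [mem_Ico] at ht
    have ht1 : 1 ≤ t := by omega
    obtain ⟨hpos, hsum⟩ := flhWeight_pos_and_sum (1 / (2 * D ^ 2)) E (sqLoss y) ht1
    refine (concaveOn_exp_neg_sq hD (y t)).le_map_sum (fun i hi => (hpos i hi).le) hsum ?_
    intro i _
    have := abs_le.1 (hy t (mem_Icc.2 ⟨ht1, by omega⟩) _ (ogd_mem (hz i) (sqLoss y) i (t - i)))
    constructor <;> simp only [hE] <;> linarith [this.1, this.2])
  have hogd := ogd_dynamic_regret (D := D) (hz r) y w r N m (by omega)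
    (fun τ hτ => hw _ (by rw [mem_Ico]; omega))
    (fun τ hτ => hy _ (by rw [mem_Icc]; omega) _ (ogd_mem (hz r) _ _ _))
  have hsplit : ∑ t ∈ Ico r (r + m + 1),
      ((flhOgd B (1 / (2 * D ^ 2)) z (sqLoss y) t - y t) ^ 2 - (w t - y t) ^ 2) =
      ∑ t ∈ Ico r (r + m + 1), (sqLoss y t (flhPlay (1 / (2 * D ^ 2)) E (sqLoss y) t)
        - sqLoss y t (E r t))
      + ∑ τ ∈ range (m + 1), ((ogd B (z r) (sqLoss y) r τ - y (r + τ)) ^ 2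
        - (w (r + τ) - y (r + τ)) ^ 2) := by
    have : ∑ τ ∈ range (m + 1), ((ogd B (z r) (sqLoss y) r τ - y (r + τ)) ^ 2
        - (w (r + τ) - y (r + τ)) ^ 2) =
        ∑ t ∈ Ico r (r + m + 1), (sqLoss y t (E r t) - (w t - y t) ^ 2) := by
      rw [sum_Ico_eq_sum_range, show r + m + 1 - r = m + 1 by omega]
      refine sum_congr rfl fun τ _ => ?_
      simp [hE, sqLoss]
    rw [this, ← sum_add_distrib]
    refine sum_congr rfl fun t _ => ?_
    simp only [flhOgd, sqLoss, hE]
    ring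
  have htv : ∑ t ∈ Ico (r + 1) (r + m + 1), |w t - w (t - 1)| =
      ∑ τ ∈ range m, |w (r + τ + 1) - w (r + τ)| := by
    rw [sum_Ico_eq_sum_range, show r + m + 1 - (r + 1) = m by omega]
    refine sum_congr rfl fun τ _ => ?_
    rw [show r + 1 + τ = r + τ + 1 by omega, Nat.add_sub_cancel]
  rw [hsplit, htv]
  have hlog1 : Real.log ((r + m + 1 : ℕ) : ℝ) ≤ 1 + Real.log n := by
    refine le_trans (Real.log_le_log (by positivity) ?_) (log_succ_le (n := n))
    exact_mod_cast hs
  have hharm : ∑ τ ∈ range (m + 1), 1 / ((τ : ℝ) + 1) ≤ 1 + Real.log n := by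
    refine (sum_range_one_div_le (m + 1)).trans ?_
    gcongr
    omega
  have hflh' : ∑ t ∈ Ico r (r + m + 1), (sqLoss y t (flhPlay (1 / (2 * D ^ 2)) E (sqLoss y) t)
        - sqLoss y t (E r t)) ≤ 2 * D ^ 2 * (1 + Real.log n) := by
    rw [one_div_mul_eq_div, div_le_iff₀ (by positivity)] at hflh
    nlinarith [sq_nonneg D]
  have h3 : D ^ 2 * ∑ τ ∈ range (m + 1), 1 / ((τ : ℝ) + 1) ≤ D ^ 2 * (1 + Real.log n) := by
    gcongr
  have h4 : 0 ≤ ((m : ℝ) + 1) * (ogd B (z r) (sqLoss y) r (m + 1) - w (r + m)) ^ 2 := by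
    positivity
  linarith

/-! ### From adaptive regret to dynamic regret: piecewise constant comparators -/

/-- Split time into maximal runs on which `k` is constant, each costing at most `L`. An integer
sequence moves by at least 1 whenever it changes, so its variation bounds the number of changes. -/
lemma sum_le_mul_one_add_changes {ρ : ℕ → ℤ → ℝ} {L : ℝ} {n : ℕ} (k : ℕ → ℤ)
    (hL : 0 ≤ L)
    (h : ∀ r s u, 1 ≤ r → r < s → s ≤ n + 1 → (∃ t, r ≤ t ∧ t < s ∧ u = k t) →
      ∑ t ∈ Ico r s, ρ t u ≤ L) :
    ∑ t ∈ Ico 1 (n + 1), ρ t (k t) ≤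
      L * (1 + ∑ t ∈ Ico 2 (n + 1), |(k t : ℝ) - k (t - 1)|) := by
  rcases Nat.eq_zero_or_pos n with rfl | hn
  · simpa using hL
  -- `r` is the start of the run containing `m`; only completed runs are charged, and the last run
  -- supplies the extra 1.
  have key : ∀ m, 1 ≤ m → m ≤ n → ∃ r, 1 ≤ r ∧ r ≤ m ∧ (∀ t ∈ Ico r (m + 1), k t = k m) ∧
      ∑ t ∈ Ico 1 r, ρ t (k t) ≤ L * ∑ t ∈ Ico 2 (m + 1), |(k t : ℝ) - k (t - 1)| := by
    intro m hm
    induction m, hm using Nat.le_induction with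
    | base =>
      intro _
      exact ⟨1, le_rfl, le_rfl, fun t ht => by rw [show t = 1 by simp at ht; omega], by simp⟩
    | succ m hm ih =>
      intro hmn
      obtain ⟨r, hr1, hrm, hk, hsum⟩ := ih (by omega)
      rw [sum_Ico_succ_top (by omega), Nat.add_sub_cancel]
      by_cases hc : k (m + 1) = k m
      · refine ⟨r, hr1, by omega, fun t ht => ?_, by simpa [hc] using hsum⟩
        rw [mem_Ico] at ht
        rcases Nat.lt_or_ge t (m + 1) with h' | h'
        · rw [hc, hk t (mem_Ico.2 ⟨ht.1, h'⟩)]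
        · rw [show t = m + 1 by omega]
      · refine ⟨m + 1, by omega, le_rfl, fun t ht => by
          rw [show t = m + 1 by simp at ht; omega], ?_⟩
        rw [← sum_Ico_consecutive _ hr1 (show r ≤ m + 1 by omega)]
        have h1 : ∑ t ∈ Ico r (m + 1), ρ t (k t) ≤ L := by
          rw [sum_congr rfl fun t ht => by rw [hk t ht]]
          exact h r (m + 1) (k m) hr1 (by omega) (by omega) ⟨m, hrm, by omega, rfl⟩
        have h2 : (1 : ℝ) ≤ |(k (m + 1) : ℝ) - k m| := by
          exact_mod_cast Int.one_le_abs (sub_ne_zero.2 hc)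
        nlinarith
  obtain ⟨r, hr1, hrn, hk, hsum⟩ := key n hn le_rfl
  rw [← sum_Ico_consecutive _ hr1 (show r ≤ n + 1 by omega)]
  have h1 : ∑ t ∈ Ico r (n + 1), ρ t (k t) ≤ L := by
    rw [sum_congr rfl fun t ht => by rw [hk t ht]]
    exact h r (n + 1) (k n) hr1 (by omega) le_rfl ⟨n, hrn, by omega, rfl⟩
  linarith

/-! ### Rounding with a random threshold -/

lemma intervalIntegrable_floor_add (a : ℝ) :
    IntervalIntegrable (fun θ => (⌊a + θ⌋ : ℝ)) MeasureTheory.volume 0 1 := by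
  refine Monotone.intervalIntegrable fun x y h => ?_
  exact_mod_cast Int.floor_mono (add_le_add_right h a)

/-- The fractional part has mean 1/2 over any period, and so does θ. -/
lemma integral_floor_add (a : ℝ) : ∫ θ in (0 : ℝ)..1, (⌊a + θ⌋ : ℝ) = a := by
  have hper : Function.Periodic (fun x : ℝ => Int.fract x) 1 := Int.fract_periodic ℝ
  have h1 : ∫ θ in (0 : ℝ)..1, Int.fract (a + θ) = 1 / 2 := by
    rw [intervalIntegral.integral_comp_add_left (fun x => Int.fract x) a, add_zero,
      hper.intervalIntegral_add_eq a 0, zero_add]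
    rw [intervalIntegral.integral_congr_Ioo_of_le (g := fun x => x) zero_le_one
      (fun x hx => Int.fract_eq_self.2 ⟨hx.1.le, hx.2⟩)]
    simp
  have hfl := intervalIntegrable_floor_add a
  have hid : IntervalIntegrable (fun θ : ℝ => a + θ) MeasureTheory.volume 0 1 :=
    (continuous_const.add continuous_id).intervalIntegrable _ _
  have h2 : ∫ θ in (0 : ℝ)..1, Int.fract (a + θ) =
      (∫ θ in (0 : ℝ)..1, (a + θ)) - ∫ θ in (0 : ℝ)..1, (⌊a + θ⌋ : ℝ) := by
    rw [← intervalIntegral.integral_sub hid hfl]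
    rfl
  have h3 : ∫ θ in (0 : ℝ)..1, (a + θ) = a + 1 / 2 := by
    rw [intervalIntegral.integral_add (by simp) (by simp)]
    simp
  linarith

/-- If `c + ∑ t, α t * ⌊a t + θ⌋` is nonnegative for every threshold `θ`, then so is its average
over `θ`. -/
lemma nonneg_of_floor_add {ι : Type*} (s : Finset ι) (c : ℝ) (α a : ι → ℝ)
    (h : ∀ θ ∈ Set.Ioo (0 : ℝ) 1, 0 ≤ c + ∑ t ∈ s, α t * (⌊a t + θ⌋ : ℝ)) :
    0 ≤ c + ∑ t ∈ s, α t * a t := by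
  have hint : ∀ t ∈ s, IntervalIntegrable (fun θ => α t * (⌊a t + θ⌋ : ℝ))
      MeasureTheory.volume 0 1 := fun t _ => (intervalIntegrable_floor_add (a t)).const_mul _
  have hsum : IntervalIntegrable (fun θ => ∑ t ∈ s, α t * (⌊a t + θ⌋ : ℝ))
      MeasureTheory.volume 0 1 := by
    simpa only [← Finset.sum_fn] using IntervalIntegrable.sum s hint
  have hpos : 0 ≤ ∫ θ in (0 : ℝ)..1, (c + ∑ t ∈ s, α t * (⌊a t + θ⌋ : ℝ)) := by
    have := intervalIntegral.integral_mono_on_of_le_Ioo (f := fun _ => (0 : ℝ)) zero_le_one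
      (by simp) ((intervalIntegrable_const (c := c)).add hsum) h
    simpa using this
  rw [intervalIntegral.integral_add (by simp) hsum, intervalIntegral.integral_finsetSum hint] at hpos
  simpa [integral_floor_add] using hpos

/-- Bounded regret against constants on all intervals gives dynamic regret, by comparison with the
rounding of `w` to a grid of mesh `2 B / M`, averaged over the rounding threshold. -/
lemma dynamic_regret_of_rounding {x y w : ℕ → ℝ} {B L : ℝ} {n M : ℕ} (hB : 0 < B) (hM : 0 < M)
    (hL : 0 ≤ L) (hw : ∀ t ∈ Ico 1 (n + 1), w t ∈ Set.Icc (-B) B)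
    (h : ∀ r s u, 1 ≤ r → r < s → s ≤ n + 1 → u ∈ Set.Icc (-B) B →
      ∑ t ∈ Ico r s, ((x t - y t) ^ 2 - (u - y t) ^ 2) ≤ L) :
    ∑ t ∈ Ico 1 (n + 1), ((x t - y t) ^ 2 - (w t - y t) ^ 2) ≤
      n * (2 * B / M) ^ 2
        + L * (1 + (∑ t ∈ Ico 2 (n + 1), |w t - w (t - 1)|) / (2 * B / M)) := by
  have hM' : (0 : ℝ) < M := by exact_mod_cast hM
  set δ := 2 * B / M with hδ
  have hδ0 : 0 < δ := by positivity
  -- Position in grid units. The rounded comparator is -B + δ⌊a t + θ⌋, which stays in [-B, B]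
  -- because 0 ≤ a t ≤ M, `M` is an integer and 0 < θ < 1.
  set a : ℕ → ℝ := fun t => (w t + B) / δ with ha
  have hwa : ∀ t, w t = -B + δ * a t := fun t => by simp only [ha]; field_simp; ring
  have haM : ∀ t ∈ Ico 1 (n + 1), 0 ≤ a t ∧ a t ≤ M := fun t ht => by
    obtain ⟨h1, h2⟩ := hw t ht
    constructor
    · exact div_nonneg (by linarith) hδ0.le
    · rw [ha, div_le_iff₀ hδ0, hδ, mul_div_cancel₀ _ hM'.ne']
      linarith
  -- Floor is monotone, so the sign of a jump of the rounded path does not depend on θ. The absolute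
  -- jumps are therefore linear in the floors and can be averaged exactly.
  set σ : ℕ → ℝ := fun t => if a (t - 1) ≤ a t then 1 else -1 with hσ
  have hσabs : ∀ t, σ t * (a t - a (t - 1)) = |a t - a (t - 1)| := fun t => by
    simp only [hσ]
    split_ifs with hc
    · rw [abs_of_nonneg (by linarith), one_mul]
    · rw [abs_of_neg (by linarith), neg_one_mul]
  have hσfl : ∀ t θ, |(⌊a t + θ⌋ : ℝ) - ⌊a (t - 1) + θ⌋| =
      σ t * ((⌊a t + θ⌋ : ℝ) - ⌊a (t - 1) + θ⌋) := fun t θ => by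
    simp only [hσ]
    split_ifs with hc
    · have : (⌊a (t - 1) + θ⌋ : ℝ) ≤ ⌊a t + θ⌋ := by
        exact_mod_cast Int.floor_mono (by linarith)
      rw [abs_of_nonneg (by linarith), one_mul]
    · have : (⌊a t + θ⌋ : ℝ) ≤ ⌊a (t - 1) + θ⌋ := by
        exact_mod_cast Int.floor_mono (by linarith)
      rw [abs_of_nonpos (by linarith), neg_one_mul]
  -- Coefficient of the first-order rounding error, whose average over θ is zero.
  obtain ⟨β, hβ⟩ : ∃ β : ℕ → ℝ, ∀ t, β t = 2 * (w t - y t) * δ := ⟨_, fun _ => rfl⟩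
  -- the bound for a fixed threshold
  have hθ : ∀ θ ∈ Set.Ioo (0 : ℝ) 1,
      ∑ t ∈ Ico 1 (n + 1), ((x t - y t) ^ 2 - (w t - y t) ^ 2) ≤
      ∑ t ∈ Ico 1 (n + 1), (β t * ((⌊a t + θ⌋ : ℝ) - a t) + δ ^ 2)
        + L * (1 + ∑ t ∈ Ico 2 (n + 1), σ t * ((⌊a t + θ⌋ : ℝ) - ⌊a (t - 1) + θ⌋)) := by
    intro θ hθ
    have hpc := sum_le_mul_one_add_changes (n := n) (L := L) (fun t => ⌊a t + θ⌋)
      (ρ := fun t u => (x t - y t) ^ 2 - (-B + δ * u - y t) ^ 2) hL (by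
        rintro r s u hr hrs hs ⟨t, hrt, hts, rfl⟩
        refine h r s _ hr hrs hs ?_
        obtain ⟨h0, h1⟩ := haM t (mem_Ico.2 ⟨by omega, by omega⟩)
        have hfl0 : (0 : ℝ) ≤ ⌊a t + θ⌋ := by
          exact_mod_cast Int.floor_nonneg.2 (by linarith [hθ.1])
        have hfl1 : (⌊a t + θ⌋ : ℝ) ≤ M := by
          have : ⌊a t + θ⌋ < (M : ℤ) + 1 := Int.floor_lt.2 (by push_cast; linarith [hθ.2])
          exact_mod_cast Int.lt_add_one_iff.1 this
        have h2 : δ * ⌊a t + θ⌋ ≤ δ * M := by gcongr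
        rw [hδ, div_mul_cancel₀ _ hM'.ne', ← hδ] at h2
        constructor
        · have := mul_nonneg hδ0.le hfl0
          linarith
        · linarith)
    simp only [hσfl] at hpc
    refine le_trans ?_ (add_le_add_right hpc _)
    rw [← sum_add_distrib]
    refine sum_le_sum fun t _ => ?_
    have h1 : |(⌊a t + θ⌋ : ℝ) - a t| ≤ 1 := by
      rw [abs_le]
      constructor <;> linarith [Int.floor_le (a t + θ), Int.lt_floor_add_one (a t + θ), hθ.1, hθ.2]
    have h2 : ((⌊a t + θ⌋ : ℝ) - a t) ^ 2 ≤ 1 := (sq_le_one_iff_abs_le_one _).2 h1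
    have h3 := mul_le_mul_of_nonneg_left h2 (sq_nonneg δ)
    have h4 : -B + δ * (⌊a t + θ⌋ : ℝ) - y t = (w t - y t) + δ * ((⌊a t + θ⌋ : ℝ) - a t) := by
      rw [hwa t]; ring
    rw [h4, hβ]
    nlinarith
  -- averaging over the threshold
  have havg := nonneg_of_floor_add
    -- One index set for three families of floors: the first-order error, and the current and
    -- previous positions in each jump.
    ((Ico 1 (n + 1)).disjSum ((Ico 2 (n + 1)).disjSum (Ico 2 (n + 1))))
    (n * δ ^ 2 + L - ∑ t ∈ Ico 1 (n + 1), β t * a t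
      - ∑ t ∈ Ico 1 (n + 1), ((x t - y t) ^ 2 - (w t - y t) ^ 2))
    (Sum.elim β (Sum.elim (fun t => L * σ t) (fun t => -(L * σ t))))
    (Sum.elim a (Sum.elim a (fun t => a (t - 1)))) (by
      intro θ hθ'
      have := hθ θ hθ'
      rw [sum_add_distrib, sum_const, Nat.card_Ico, nsmul_eq_mul, mul_add, mul_sum] at this
      simp only [mul_sub, sum_sub_distrib, add_tsub_cancel_right] at this
      simp only [sum_disjSum, Sum.elim_inl, Sum.elim_inr, neg_mul, sum_neg_distrib, mul_assoc,
        sum_sub_distrib]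
      linarith)
  simp only [sum_disjSum, Sum.elim_inl, Sum.elim_inr, neg_mul, sum_neg_distrib] at havg
  have hTV : (∑ t ∈ Ico 2 (n + 1), |w t - w (t - 1)|) / δ =
      ∑ t ∈ Ico 2 (n + 1), σ t * (a t - a (t - 1)) := by
    rw [sum_div]
    refine sum_congr rfl fun t _ => ?_
    rw [hσabs, hwa t, hwa (t - 1), show -B + δ * a t - (-B + δ * a (t - 1)) =
      δ * (a t - a (t - 1)) by ring, abs_mul, abs_of_pos hδ0, mul_div_cancel_left₀ _ hδ0.ne']
  rw [hTV, mul_add, mul_sum]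
  have : ∑ t ∈ Ico 2 (n + 1), L * (σ t * (a t - a (t - 1))) =
      ∑ t ∈ Ico 2 (n + 1), L * σ t * a t - ∑ t ∈ Ico 2 (n + 1), L * σ t * a (t - 1) := by
    rw [← sum_sub_distrib]
    exact sum_congr rfl fun t _ => by ring
  linarith

/-! ### From adaptive regret to dynamic regret: blocks of equal length -/

/-- Peel off the last `N` rounds repeatedly: at most m/N + 1 blocks arise, and their inner
variations are disjoint parts of the total. -/
lemma sum_le_of_blocks {ρ τ : ℕ → ℝ} {L K : ℝ} {n N : ℕ} (hN : 0 < N) (hL : 0 ≤ L)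
    (hK : 0 ≤ K) (hτ : ∀ t, 0 ≤ τ t)
    (h : ∀ r s, 1 ≤ r → r < s → s ≤ n + 1 → s ≤ r + N →
      ∑ t ∈ Ico r s, ρ t ≤ L + K * ∑ t ∈ Ico (r + 1) s, τ t) (m : ℕ) (hm : m ≤ n) :
    ∑ t ∈ Ico 1 (m + 1), ρ t ≤ L * (m / N + 1) + K * ∑ t ∈ Ico 2 (m + 1), τ t := by
  have hN' : (0 : ℝ) < N := by exact_mod_cast hN
  induction m using Nat.strong_induction_on with
  | _ m ih =>
    rcases Nat.eq_zero_or_pos m with rfl | hm0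
    · simpa using hL
    rcases Nat.lt_or_ge N m with hlt | hge
    · have h1 := ih (m - N) (by omega) (by omega)
      have h2 := h (m - N + 1) (m + 1) (by omega) (by omega) (by omega) (by omega)
      have h3 : ∑ t ∈ Ico (m - N + 1 + 1) (m + 1), τ t ≤ ∑ t ∈ Ico (m - N + 1) (m + 1), τ t :=
        sum_le_sum_of_subset_of_nonneg (Ico_subset_Ico_left (by omega)) fun t _ _ => hτ t
      have h4 := mul_le_mul_of_nonneg_left h3 hK
      rw [← sum_Ico_consecutive ρ (show 1 ≤ m - N + 1 by omega) (show m - N + 1 ≤ m + 1 by omega),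
        ← sum_Ico_consecutive τ (show 2 ≤ m - N + 1 by omega) (show m - N + 1 ≤ m + 1 by omega)]
      rw [Nat.cast_sub hlt.le, sub_div, div_self hN'.ne'] at h1
      linarith
    · have h1 := h 1 (m + 1) le_rfl (by omega) (by omega) (by omega)
      have : 0 ≤ L * ((m : ℝ) / N) := by positivity
      linarith

/-! ### Dynamic regret of univariate FLH-OGD -/

/-- Dynamic regret of univariate FLH-OGD on `[-B, B]` for squared losses, uniformly over `B ≤ R`. -/
theorem flhOgd_dynamic_regret {B D R : ℝ} (hD : 0 < D) (hDR : D ≤ 4 * R) (hBR : B ≤ R)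
    {z : ℕ → ℝ} (hz : ∀ j, z j ∈ Set.Icc (-B) B) {n : ℕ} (hn : 1 ≤ n) {y w : ℕ → ℝ}
    (hy : ∀ t ∈ Icc 1 n, ∀ e ∈ Set.Icc (-B) B, |e - y t| ≤ D)
    (hw : ∀ t ∈ Icc 1 n, w t ∈ Set.Icc (-B) B) :
    ∑ t ∈ Icc 1 n, ((flhOgd B (1 / (2 * D ^ 2)) z (sqLoss y) t - y t) ^ 2 - (w t - y t) ^ 2) ≤
      (2 + 4 * R + 96 * R ^ 2) * (1 + Real.log n) *
        (1 + (n : ℝ) ^ (1 / 3 : ℝ) * (∑ t ∈ Icc 2 n, |w t - w (t - 1)|) ^ (2 / 3 : ℝ)) := by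
  simp only [← Ico_add_one_right_eq_Icc] at hw ⊢
  have hB : 0 ≤ B := by linarith [(hz 0).1, (hz 0).2]
  have hR : 0 < R := by linarith
  have hn' : (1 : ℝ) ≤ n := by exact_mod_cast hn
  have hΛ : 1 ≤ 1 + Real.log n := by linarith [Real.log_nonneg hn']
  set Λ := 1 + Real.log n with hΛdef
  set V := ∑ t ∈ Ico 2 (n + 1), |w t - w (t - 1)| with hV
  have hV0 : 0 ≤ V := sum_nonneg fun t _ => abs_nonneg _
  have hVB : V ≤ 2 * B * n := by
    have h1 : V ≤ ∑ t ∈ Ico 2 (n + 1), 2 * B := by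
      refine sum_le_sum fun t ht => ?_
      rw [mem_Ico] at ht
      have h2 := hw t (mem_Ico.2 ⟨by omega, ht.2⟩)
      have h3 := hw (t - 1) (mem_Ico.2 ⟨by omega, by omega⟩)
      rw [abs_le]
      constructor <;> linarith [h2.1, h2.2, h3.1, h3.2]
    rw [sum_const, Nat.card_Ico, nsmul_eq_mul] at h1
    have h2 : ((n + 1 - 2 : ℕ) : ℝ) ≤ n := by exact_mod_cast (show n + 1 - 2 ≤ n by omega)
    nlinarith
  -- q = (V/n)^{1/3} balances the squared rounding error n q² against the number of changes V/q.
  obtain ⟨q, hq0, hqV⟩ : ∃ q : ℝ, 0 ≤ q ∧ V = q ^ 3 * n := by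
    refine ⟨(V / n) ^ (1 / 3 : ℝ), by positivity, ?_⟩
    rw [← Real.rpow_natCast, ← Real.rpow_mul (by positivity)]
    norm_num
    field_simp
  have hQ : (n : ℝ) ^ (1 / 3 : ℝ) * V ^ (2 / 3 : ℝ) = n * q ^ 2 := by
    rw [hqV, Real.mul_rpow (by positivity) (by positivity), ← Real.rpow_natCast,
      ← Real.rpow_mul hq0, mul_left_comm, ← Real.rpow_add (by linarith)]
    norm_num
    ring
  rw [hQ]
  set Q := (n : ℝ) * q ^ 2 with hQdef
  have hQ0 : 0 ≤ Q := by positivity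
  set L := 3 * D ^ 2 * Λ with hL
  have hL0 : 0 ≤ L := by positivity
  have hLR : L ≤ 48 * R ^ 2 * Λ := by
    rw [hL]
    refine mul_le_mul_of_nonneg_right ?_ (by linarith)
    nlinarith
  have hadapt : ∀ (v : ℕ → ℝ) (r s N : ℕ), 1 ≤ r → r < s → s ≤ n + 1 → s ≤ r + N →
      (∀ t ∈ Ico r s, v t ∈ Set.Icc (-B) B) →
      ∑ t ∈ Ico r s, ((flhOgd B (1 / (2 * D ^ 2)) z (sqLoss y) t - y t) ^ 2
        - (v t - y t) ^ 2) ≤ L + 4 * B * N * ∑ t ∈ Ico (r + 1) s, |v t - v (t - 1)| :=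
    fun v r s N hr hrs hs hN hv => flhOgd_adaptive_regret hD hz hy hr hrs hs hN hv
  -- The constant covers the three cases below: (a, b) = (1, 0), (2, 1) and (1, 2 + 4R + 8R²).
  have hfinal : ∀ U a b : ℝ, U ≤ a * L * (1 + Q) + b * Q → 0 ≤ a → 0 ≤ b →
      48 * R ^ 2 * a + b ≤ 2 + 4 * R + 96 * R ^ 2 →
      U ≤ (2 + 4 * R + 96 * R ^ 2) * Λ * (1 + Q) := by
    intro U a b hU ha hb hab
    have h1 : a * L * (1 + Q) ≤ a * (48 * R ^ 2 * Λ) * (1 + Q) := by gcongr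
    have h2 : b * Q ≤ b * Λ * (1 + Q) := by
      have : b * 1 * (0 + Q) ≤ b * Λ * (1 + Q) := by gcongr; norm_num
      linarith
    have h3 : (48 * R ^ 2 * a + b) * Λ * (1 + Q) ≤
        (2 + 4 * R + 96 * R ^ 2) * Λ * (1 + Q) := by gcongr
    linarith
  rcases hq0.eq_or_lt with hq | hq
  -- Here V = 0, so a single interval suffices.
  · have h1 := hadapt w 1 (n + 1) n le_rfl (by omega) le_rfl (by omega) hw
    rw [← hV, hqV, ← hq] at h1
    refine hfinal _ 1 0 (h1.trans ?_) zero_le_one le_rfl (by nlinarith)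
    have : 0 ≤ L * Q := by positivity
    linarith
  rcases le_or_gt q (2 * B) with hqB | hqB
  · have hB0 : 0 < B := by linarith
    -- The mesh 2B/M lies between q/2 and q; the lower bound uses q ≤ 2B.
    set M := ⌈2 * B / q⌉₊ with hMdef
    have hM1 : 2 * B / q ≤ M := Nat.le_ceil _
    have hM2 : (M : ℝ) < 2 * B / q + 1 := Nat.ceil_lt_add_one (by positivity)
    have hM0 : 0 < M := Nat.ceil_pos.2 (by positivity)
    have hM0' : (0 : ℝ) < M := by exact_mod_cast hM0
    have h1 := dynamic_regret_of_rounding hB0 hM0 hL0 hw (fun r s u hr hrs hs hu =>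
      (hadapt (fun _ => u) r s s hr hrs hs (by omega) (fun _ _ => hu)).trans (by simp))
    have hδ : 2 * B / M ≤ q := by
      rw [div_le_iff₀ hM0']
      rwa [div_le_iff₀ hq, mul_comm (M : ℝ)] at hM1
    have h2 : n * (2 * B / M) ^ 2 ≤ Q := by rw [hQdef]; gcongr
    have h3 : V / (2 * B / M) ≤ 2 * Q := by
      have hMq : M * q ≤ 4 * B := by
        have := mul_lt_mul_of_pos_right hM2 hq
        rw [add_mul, div_mul_cancel₀ _ hq.ne'] at this
        linarith
      rw [div_div_eq_mul_div, div_le_iff₀ (by positivity), hqV, hQdef]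
      have := mul_le_mul_of_nonneg_left hMq hQ0
      rw [hQdef] at this
      nlinarith
    rw [← hV] at h1
    have h4 := mul_le_mul_of_nonneg_left h3 hL0
    refine hfinal _ 2 1 (h1.trans ?_) zero_le_two zero_le_one (by nlinarith)
    linarith
  -- There are at most Q + 1 blocks, and movement costs 4BNV ≤ 4Bqn + 4BqQ. The first term is at
  -- most 2Q as 2B < q; the second uses q ≤ 1 + 2R, from q³ = V/n ≤ 2B.
  · set N := ⌈1 / q ^ 2⌉₊ with hNdef
    have hN1 : 1 / q ^ 2 ≤ N := Nat.le_ceil _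
    have hN2 : (N : ℝ) < 1 / q ^ 2 + 1 := Nat.ceil_lt_add_one (by positivity)
    have hN0 : 0 < N := Nat.ceil_pos.2 (by positivity)
    have hN0' : (0 : ℝ) < N := by exact_mod_cast hN0
    have h1 := sum_le_of_blocks (n := n) hN0 hL0 (by positivity : 0 ≤ 4 * B * (N : ℝ))
      (fun t => abs_nonneg (w t - w (t - 1))) (fun r s hr hrs hs hN =>
        hadapt w r s N hr hrs hs hN fun t ht => hw t (by simp at ht ⊢; omega)) n le_rfl
    rw [← hV] at h1
    have h2 : (n : ℝ) / N ≤ Q := by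
      rw [div_le_iff₀ hN0', hQdef]
      rw [div_le_iff₀ (by positivity)] at hN1
      nlinarith
    have hq3 : q ^ 3 ≤ 2 * B := by
      rw [hqV] at hVB
      exact le_of_mul_le_mul_right hVB (by linarith)
    have hq1 : q ≤ 1 + 2 * R := by
      rcases le_total q 1 with h | h
      · linarith
      · have : q ≤ q ^ 3 := le_self_pow₀ h (by norm_num)
        linarith
    have h3 : 4 * B * N * V ≤ (2 + 4 * R + 8 * R ^ 2) * Q := by
      have h4 : 4 * B * N * V ≤ 4 * B * (1 / q ^ 2 + 1) * V := by gcongr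
      have h5 : 4 * B * (1 / q ^ 2 + 1) * V = 4 * B * q * n + 4 * B * q * Q := by
        rw [hqV, hQdef]
        field_simp
      have h6 : 4 * B * q * n ≤ 2 * Q := by
        rw [hQdef]
        have : 2 * B * (2 * q * n) ≤ q * (2 * q * n) := by gcongr
        linarith
      have h7 : 4 * B * q * Q ≤ 4 * R * (1 + 2 * R) * Q := by gcongr
      linarith
    have h4 := mul_le_mul_of_nonneg_left h2 hL0
    refine hfinal _ 1 (2 + 4 * R + 8 * R ^ 2) (h1.trans ?_) zero_le_one
      (by positivity) (by nlinarith)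
    linarith

/-! ### The reduction -/

lemma mem_box_iff {d : ℕ} {B : ℝ} (hB : 0 ≤ B) {x : Fin d → ℝ} :
    x ∈ box d B ↔ ∀ i, x i ∈ Set.Icc (-B) B := by
  simp only [box, Set.mem_ofPred_eq, pi_norm_le_iff_of_nonneg hB, Real.norm_eq_abs, abs_le,
    Set.mem_Icc]

lemma boxRadius_nonneg {d : ℕ} (W : Set (Fin d → ℝ)) : 0 ≤ boxRadius W :=
  Real.sSup_nonneg (by rintro _ ⟨w, _, rfl⟩; exact norm_nonneg w)

lemma subset_box {d : ℕ} {W : Set (Fin d → ℝ)} (hW : Bornology.IsBounded W) :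
    W ⊆ box d (boxRadius W) := by
  intro w hw
  obtain ⟨C, hC⟩ := hW.exists_norm_le
  exact le_csSup ⟨C, by rintro _ ⟨v, hv, rfl⟩; exact hC v hv⟩ ⟨w, hw, rfl⟩

lemma sum_mul_le_l1Norm {d : ℕ} {G : ℝ} {a x : Fin d → ℝ} (ha : ∀ i, |a i| ≤ G) :
    ∑ i, a i * x i ≤ G * l1Norm x := by
  rw [l1Norm, mul_sum]
  refine sum_le_sum fun i _ => (le_abs_self _).trans ?_
  rw [abs_mul]
  gcongr
  exact ha i

namespace IsStronglyConvexLoss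

variable {d : ℕ} {H G B : ℝ} {f : (Fin d → ℝ) → ℝ} {g : (Fin d → ℝ) → Fin d → ℝ}

lemma abs_le (h : IsStronglyConvexLoss H G B f g) {x : Fin d → ℝ} (hx : x ∈ box d B)
    (i : Fin d) : |g x i| ≤ G :=
  (norm_le_pi_norm (g x) i).trans (h.bound x hx)

/-- Strong convexity with bounded gradients limits the radius of the box. -/
lemma radius_le (h : IsStronglyConvexLoss H G B f g) (hd : 0 < d) (hH : 0 < H) (hG : 0 < G)
    (hB : 0 ≤ B) : B ≤ G / H := by
  rcases hB.eq_or_lt with rfl | hB'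
  · positivity
  -- Adding the strong convexity inequalities between two opposite corners, in both directions,
  -- gives 4dHB² ≤ 4dGB.
  have hx : (fun _ => B : Fin d → ℝ) ∈ box d B := (mem_box_iff hB).2 fun i => ⟨by linarith, le_rfl⟩
  have hy : (fun _ => -B : Fin d → ℝ) ∈ box d B := (mem_box_iff hB).2 fun i => ⟨le_rfl, by linarith⟩
  have h1 := h.strong _ hx _ hy
  have h2 := h.strong _ hy _ hx
  set a := g fun _ => B
  set b := g fun _ => -B
  have h3 : ∑ i, b i * (B - -B) ≥ ∑ _i : Fin d, -(G * (2 * B)) := by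
    refine sum_le_sum fun i _ => ?_
    nlinarith [(_root_.abs_le.1 (h.abs_le hy i)).1]
  have h4 : ∑ i, a i * (-B - B) ≥ ∑ _i : Fin d, -(G * (2 * B)) := by
    refine sum_le_sum fun i _ => ?_
    nlinarith [(_root_.abs_le.1 (h.abs_le hx i)).2]
  simp only [sum_const, card_univ, Fintype.card_fin, nsmul_eq_mul] at h1 h2 h3 h4
  have hd' : (0 : ℝ) < d := by exact_mod_cast hd
  have h5 : (4 * d * B) * (H * B) ≤ (4 * d * B) * G := by nlinarith
  rw [le_div_iff₀ hH, mul_comm]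
  exact le_of_mul_le_mul_left h5 (by positivity)

lemma le_add_l1Norm (h : IsStronglyConvexLoss H G B f g) (hH : 0 < H) {x u : Fin d → ℝ}
    (hx : x ∈ box d B) (hu : u ∈ box d B) : f u ≤ f x + G * l1Norm (x - u) := by
  have h1 := h.strong u hu x hx
  have h2 : ∑ i, -g u i * (x - u) i ≤ G * l1Norm (x - u) :=
    sum_mul_le_l1Norm fun i => by rw [abs_neg]; exact h.abs_le hu i
  simp only [Pi.sub_apply, neg_mul, sum_neg_distrib] at h2
  have h3 : 0 ≤ H / 2 * ∑ i, (x i - u i) ^ 2 := by positivity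
  linarith

end IsStronglyConvexLoss

lemma l1Gap_eq_zero {d : ℕ} {W : Set (Fin d → ℝ)} {proj : (Fin d → ℝ) → Fin d → ℝ}
    (hproj : IsL1Projection W proj) {u : Fin d → ℝ} (hu : u ∈ W) : l1Gap proj u = 0 := by
  have h0 : 0 ≤ l1Gap proj u := by
    unfold l1Gap l1Norm
    positivity
  refine le_antisymm ?_ h0
  simpa [l1Gap, l1Norm] using (hproj u).2 u hu

lemma l1Gap_le {d : ℕ} {W : Set (Fin d → ℝ)} {proj : (Fin d → ℝ) → Fin d → ℝ}
    (hproj : IsL1Projection W proj) (x u : Fin d → ℝ) :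
    l1Gap proj u ≤ l1Norm (u - x) + l1Gap proj x := by
  refine ((hproj u).2 _ (hproj x).1).trans ?_
  simp only [l1Gap, l1Norm, ← sum_add_distrib, Pi.sub_apply]
  exact sum_le_sum fun i _ => abs_sub_le _ _ _

/-- S is 1-Lipschitz in ℓ¹, so testing along coordinate axes bounds each entry of a subgradient.
Hence |p i| ≤ 2G, which is why the box algorithm runs with `Ginf = 2 G`. -/
lemma abs_subgradient_l1Gap_le {d : ℕ} {W : Set (Fin d → ℝ)}
    {proj : (Fin d → ℝ) → Fin d → ℝ} (hproj : IsL1Projection W proj) {x s : Fin d → ℝ}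
    (hs : s ∈ subdifferential (l1Gap proj) x) (i : Fin d) : |s i| ≤ 1 := by
  have key : ∀ c : ℝ, s i * c ≤ |c| := fun c => by
    have h1 := hs (x + Pi.single i c)
    have h2 := l1Gap_le hproj x (x + Pi.single i c)
    simp only [l1Norm, Pi.add_apply, add_sub_cancel_left] at h1 h2
    rw [sum_eq_single i (by intro j _ hj; simp [hj]) (by simp)] at h1
    rw [sum_eq_single i (by intro j _ hj; simp [hj]) (by simp)] at h2
    simp only [Pi.single_eq_same] at h1 h2
    linarith
  have h1 := key 1
  have h2 := key (-1)
  rw [abs_one] at h1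
  rw [abs_neg, abs_one] at h2
  rw [abs_le]
  constructor <;> linarith

/-- The instantaneous regret of the learner is bounded by the regrets of the coordinates for the
univariate surrogate losses. -/
lemma sub_le_sum_coord {d : ℕ} {W : Set (Fin d → ℝ)} {proj : (Fin d → ℝ) → Fin d → ℝ}
    {H G B : ℝ} {f : (Fin d → ℝ) → ℝ} {g : (Fin d → ℝ) → Fin d → ℝ} (hH : 0 < H)
    (hWB : W ⊆ box d B) (hproj : IsL1Projection W proj) (hf : IsStronglyConvexLoss H G B f g)
    (hG : 0 ≤ G) {x p u : Fin d → ℝ} (hx : x ∈ box d B)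
    (hp : p ∈ surrogateGradients G proj g x) (hu : u ∈ W) :
    f (proj x) - f u ≤
      H / 2 * ∑ i, ((x i - (x i - p i / H)) ^ 2 - (u i - (x i - p i / H)) ^ 2) := by
  obtain ⟨s, hs, rfl⟩ := hp
  have h1 := hf.le_add_l1Norm hH hx (hWB (hproj x).1)
  have h2 := hf.strong x hx u (hWB hu)
  have h3 := mul_le_mul_of_nonneg_left (hs u) hG
  rw [l1Gap_eq_zero hproj hu, l1Gap, mul_zero, mul_add, mul_sum] at h3
  -- Completing the square: the linear and quadratic terms of the lower bound on the surrogate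
  -- become a difference of squared losses.
  have h4 : H / 2 * ∑ i, ((x i - (x i - (g x + G • s) i / H)) ^ 2
      - (u i - (x i - (g x + G • s) i / H)) ^ 2) =
      -(∑ i, g x i * (u i - x i) + ∑ i, G * (s i * (u i - x i))
        + H / 2 * ∑ i, (u i - x i) ^ 2) := by
    simp only [mul_sum, ← sum_add_distrib, ← sum_neg_distrib]
    refine sum_congr rfl fun i _ => ?_
    simp only [Pi.add_apply, Pi.smul_apply, smul_eq_mul]
    field_simp
    ring
  rw [h4]
  linarith

/-- Hölder against the constant 1 with exponents 3 and 3/2. -/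
lemma sum_rpow_two_thirds_le {d : ℕ} {V : Fin d → ℝ} (hV : ∀ i, 0 ≤ V i) :
    ∑ i, V i ^ (2 / 3 : ℝ) ≤ (d : ℝ) ^ (1 / 3 : ℝ) * (∑ i, V i) ^ (2 / 3 : ℝ) := by
  have hpq : Real.HolderConjugate 3 (3 / 2) := by
    rw [Real.holderConjugate_iff]
    norm_num
  have h := Real.inner_le_Lp_mul_Lq_of_nonneg (s := univ) hpq (f := fun _ : Fin d => (1 : ℝ))
    (g := fun i => V i ^ (2 / 3 : ℝ)) (fun _ _ => zero_le_one)
    (fun i _ => Real.rpow_nonneg (hV i) _)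
  have h2 : ∀ i, (V i ^ (2 / 3 : ℝ)) ^ (3 / 2 : ℝ) = V i := fun i => by
    rw [← Real.rpow_mul (hV i)]
    norm_num
  simpa [h2] using h

end BoxReduction

theorem mainTheorem3 :
    ∃ k : ℕ, ∀ H G : ℝ, 0 < H → 0 < G → ∃ K : ℝ, 0 < K ∧
      ∀ (d n : ℕ) (W : Set (Fin d → ℝ)),
        W.Nonempty → Convex ℝ W → IsClosed W → Bornology.IsBounded W →
      ∀ (f : ℕ → (Fin d → ℝ) → ℝ) (g : ℕ → (Fin d → ℝ) → (Fin d → ℝ)),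
        (∀ t ∈ Finset.Icc 1 n,
          BoxReduction.IsStronglyConvexLoss H G (BoxReduction.boxRadius W) (f t) (g t)) →
      ∀ proj : (Fin d → ℝ) → (Fin d → ℝ), BoxReduction.IsL1Projection W proj →
      ∀ (z₁ : Fin d → ℕ → ℝ) (p x xhat : ℕ → Fin d → ℝ),
        BoxReduction.IsReductionRun n W H G proj g z₁ p x xhat →
        (∀ t ∈ Finset.Icc 1 n, xhat t ∈ W) ∧
        ∀ (C : ℝ) (w : ℕ → Fin d → ℝ),
          (∀ t ∈ Finset.Icc 1 n, w t ∈ W) → BoxReduction.totalVariation n w ≤ C →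
          ∑ t ∈ Finset.Icc 1 n, (f t (xhat t) - f t (w t)) ≤
            K * (1 + Real.log n) ^ k *
              max ((d : ℝ) ^ (1 / 3 : ℝ) * (n : ℝ) ^ (1 / 3 : ℝ) * C ^ (2 / 3 : ℝ)) (d : ℝ) := by
  open BoxReduction in
  -- The factor 1/2 from strong convexity cancels the 2 in d + A ≤ 2 max(A, d).
  refine ⟨1, fun H G hH hG => ⟨H * (2 + 4 * (G / H) + 96 * (G / H) ^ 2), by positivity, ?_⟩⟩
  intro d n W _ _ _ hWb f g hf proj hproj z₁ p x xhat hrun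
  have hxhat : ∀ t ∈ Icc 1 n, xhat t ∈ W := fun t ht => by
    rw [hrun.play t ht]
    exact (hproj _).1
  refine ⟨hxhat, fun C w hw hC => ?_⟩
  rcases Nat.eq_zero_or_pos n with rfl | hn
  · simp
    positivity
  set B := boxRadius W
  set R := G / H with hRdef
  -- Bounds the distance from any point of [-B, B] to a label x - p/H, so the prescribed learning
  -- rate is exactly 1/(2D²).
  set D := 2 * B + 2 * G / H with hDdef
  have hR : 0 < R := by positivity
  have hB : 0 ≤ B := boxRadius_nonneg W
  have hD : D = 2 * B + 2 * R := by rw [hDdef, hRdef, mul_div_assoc]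
  have hWB : W ⊆ box d B := subset_box hWb
  have hxi : ∀ t ∈ Icc 1 n, ∀ i, x t i ∈ Set.Icc (-B) B := fun t ht i => by
    rw [hrun.predict t ht i]
    exact flhOgd_mem (hrun.start i) _ _ (mem_Icc.1 ht).1
  have hx : ∀ t ∈ Icc 1 n, x t ∈ box d B := fun t ht => (mem_box_iff hB).2 (hxi t ht)
  have hp : ∀ t ∈ Icc 1 n, ∀ i, |p t i / H| ≤ 2 * R := fun t ht i => by
    obtain ⟨s, hs, hps⟩ := hrun.feedback t ht
    have h1 := abs_subgradient_l1Gap_le hproj hs i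
    have h2 := (hf t ht).abs_le (hx t ht) i
    have h3 : |G * s i| ≤ G := by
      rw [abs_mul, abs_of_pos hG]
      nlinarith
    rw [abs_div, abs_of_pos hH, hRdef, ← mul_div_assoc, hps]
    gcongr
    exact (abs_add_le _ _).trans (by simp only [Pi.smul_apply, smul_eq_mul]; linarith)
  set V : Fin d → ℝ := fun i => ∑ t ∈ Icc 2 n, |w t i - w (t - 1) i|
  have hV0 : ∀ i, 0 ≤ V i := fun i => sum_nonneg fun t _ => abs_nonneg _
  have hVC : ∑ i, V i ≤ C := by
    refine le_of_eq_of_le ?_ hC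
    rw [totalVariation, sum_comm]
    rfl
  have hcoord : ∀ i, ∑ t ∈ Icc 1 n, ((x t i - (x t i - p t i / H)) ^ 2
      - (w t i - (x t i - p t i / H)) ^ 2) ≤ (2 + 4 * R + 96 * R ^ 2) * (1 + Real.log n) *
        (1 + (n : ℝ) ^ (1 / 3 : ℝ) * V i ^ (2 / 3 : ℝ)) := fun i => by
    -- The radius bound needs a loss and a positive dimension: round 1 and the coordinate `i`
    -- provide them.
    have hBR : B ≤ R := (hf 1 (mem_Icc.2 ⟨le_rfl, hn⟩)).radius_le i.pos hH hG hB
    have h := flhOgd_dynamic_regret (B := B) (D := D) (R := R) (by linarith) (by linarith) hBR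
      (hrun.start i) hn (y := fun t => x t i - p t i / H) (w := fun t => w t i)
      (fun t ht e he => by
        have h1 := hxi t ht i
        have h2 := abs_le.1 (hp t ht i)
        rw [abs_le]
        constructor <;> linarith [h1.1, h1.2, h2.1, h2.2, he.1, he.2])
      (fun t ht => (mem_box_iff hB).1 (hWB (hw t ht)) i)
    refine le_of_eq_of_le (sum_congr rfl fun t ht => ?_) h
    rw [← show x t i = flhOgd B (1 / (2 * D ^ 2)) (z₁ i)
      (sqLoss fun t => x t i - p t i / H) t from hrun.predict t ht i]
  have hΛ : 0 < 1 + Real.log n := by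
    have := Real.log_natCast_nonneg n
    linarith
  set A := (d : ℝ) ^ (1 / 3 : ℝ) * (n : ℝ) ^ (1 / 3 : ℝ) * C ^ (2 / 3 : ℝ)
  have hsum : ∑ i, (1 + (n : ℝ) ^ (1 / 3 : ℝ) * V i ^ (2 / 3 : ℝ)) ≤ 2 * max A d := by
    rw [sum_add_distrib, ← mul_sum]
    have h1 := sum_rpow_two_thirds_le hV0
    have h2 : (∑ i, V i) ^ (2 / 3 : ℝ) ≤ C ^ (2 / 3 : ℝ) :=
      Real.rpow_le_rpow (sum_nonneg fun i _ => hV0 i) hVC (by norm_num)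
    have h3 : (n : ℝ) ^ (1 / 3 : ℝ) * ∑ i, V i ^ (2 / 3 : ℝ) ≤
        (n : ℝ) ^ (1 / 3 : ℝ) * ((d : ℝ) ^ (1 / 3 : ℝ) * C ^ (2 / 3 : ℝ)) := by
      gcongr
      exact h1.trans (by gcongr)
    have h4 : (n : ℝ) ^ (1 / 3 : ℝ) * ((d : ℝ) ^ (1 / 3 : ℝ) * C ^ (2 / 3 : ℝ)) = A := by ring
    have h5 : ∑ _i : Fin d, (1 : ℝ) = d := by simp
    linarith [le_max_left A d, le_max_right A d]
  calc ∑ t ∈ Icc 1 n, (f t (xhat t) - f t (w t))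
      ≤ ∑ t ∈ Icc 1 n, H / 2 * ∑ i, ((x t i - (x t i - p t i / H)) ^ 2
          - (w t i - (x t i - p t i / H)) ^ 2) := by
        refine sum_le_sum fun t ht => ?_
        rw [hrun.play t ht]
        exact sub_le_sum_coord hH hWB hproj (hf t ht) hG.le (hx t ht) (hrun.feedback t ht) (hw t ht)
    _ = H / 2 * ∑ i, ∑ t ∈ Icc 1 n, ((x t i - (x t i - p t i / H)) ^ 2
          - (w t i - (x t i - p t i / H)) ^ 2) := by rw [← mul_sum, sum_comm]
    _ ≤ H / 2 * ∑ i, (2 + 4 * R + 96 * R ^ 2) * (1 + Real.log n) *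
          (1 + (n : ℝ) ^ (1 / 3 : ℝ) * V i ^ (2 / 3 : ℝ)) := by
        gcongr with i
        exact hcoord i
    _ ≤ H / 2 * ((2 + 4 * R + 96 * R ^ 2) * (1 + Real.log n) * (2 * max A d)) := by
        rw [← mul_sum]
        gcongr
    _ = H * (2 + 4 * R + 96 * R ^ 2) * (1 + Real.log n) ^ 1 * max A d := by ring
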